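/- Let $K$ be a field, $\mathcal L$ a finite distributive lattice, $A=K[x_\alpha:\alpha\in\mathcal L]$, and write $\alpha\nsim\beta$ if $\alpha,\beta$ are incomparable. For $\alpha,\beta\in\mathcal L$ put $f_{(\alpha,\beta)}=x_\alpha x_\beta-x_{\alpha\vee\beta}x_{\alpha\wedge\beta}$, let $I_{\mathcal L}=\langle f_{(\alpha,\beta)}:\alpha\nsim\beta\rangle$, and let $R[\mathcal L]=A/I_{\mathcal L}$ be the Hibi ring. Let $F$ be the free $A$-module with one basis element $g_{(\alpha,\beta)}=g_{(\beta,\alpha)}$ for each unordered pair $\alpha\nsim\beta$; put $g_{(\alpha,\beta)}=0$ if $\alpha,\beta$ are comparable (then $f_{(\alpha,\beta)}=0$). Let $\varphi:F\to A$ be the $A$-linear map with $\varphi(g_{(\alpha,\beta)})=f_{(\alpha,\beta)}$; its image is $I_{\mathcal L}$, and $\ker\varphi$ is the first syzygy module of $R[\mathcal L]$. **Theorem.** The $A$-module $\ker\varphi$ is generated by all elements of the following types $S_1,S_2,L,B_1,B_2,G_1,\dots,G_6,G,D$. In all types except $D$, $\alpha,\beta_1,\beta_2$ range over all elements of $\mathcal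 L$ with $\alpha\nsim\beta_1$, $\alpha\nsim\beta_2$ and the listed conditions. * If $\alpha\vee\beta_1\ne\alpha\vee\beta_2$, $\alpha\wedge\beta_1=\alpha\wedge\beta_2$, $\beta_1\le\beta_2$, $\beta_1\le\alpha\vee\beta_2$, $\beta_1\ge\alpha\wedge\beta_2$, $\beta_2\nsim\alpha\vee\beta_1$, $\beta_2\ge\alpha\wedge\beta_1$ (strip types): $$S_1=-x_{\beta_2}g_{(\alpha,\beta_1)}+x_{\beta_1}g_{(\alpha,\beta_2)}-x_{\alpha\wedge\beta_1}g_{(\beta_2,\alpha\vee\beta_1)},$$ $$S_2=x_{\alpha\vee\beta_2}g_{(\alpha,\beta_1)}-x_{\alpha\vee\beta_1}g_{(\alpha,\beta_2)}+x_{\alpha}g_{(\beta_2,\alpha\vee\beta_1)}.$$ * If $\alpha\wedge\beta_1\ne\alpha\wedge\beta_2$, $\alpha\vee\beta_1\ne\alpha\vee\beta_2$, $\beta_1\le\beta_2$, $\beta_1\le\alpha\vee\beta_2$, $\beta_1\nsim\alpha\wedge\beta_2$, $\beta_2\nsim\alpha\vee\beta_1$, $\beta_2\ge\alpha\wedge\beta_1$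 ($L$-type): $$L=-x_{\beta_2}g_{(\alpha,\beta_1)}+x_{\beta_1}g_{(\alpha,\beta_2)}+x_{\alpha\vee\beta_2}g_{(\beta_1,\alpha\wedge\beta_2)}-x_{\alpha\wedge\beta_1}g_{(\beta_2,\alpha\vee\beta_1)}.$$ * If $\alpha\wedge\beta_1\ne\alpha\wedge\beta_2$, $\alpha\vee\beta_1\ne\alpha\vee\beta_2$, $\beta_1\nsim\beta_2$, $\beta_1\le\alpha\vee\beta_2$, $\beta_1\ge\alpha\wedge\beta_2$, $\beta_2\nsim\alpha\vee\beta_1$, $\beta_2\nsim\alpha\wedge\beta_1$ (box types): $$B_1=-x_{\beta_2}g_{(\alpha,\beta_1)}+x_{\beta_1}g_{(\alpha,\beta_2)}-x_{\alpha\vee\beta_1}g_{(\beta_2,\alpha\wedge\beta_1)}-x_{\alpha\wedge\beta_2}g_{(\alpha\vee\beta_1,\beta_1\vee\beta_2)},$$ $$B_2=-x_{\beta_1}g_{(\alpha,\beta_2)}+x_{\alpha}g_{(\beta_1,\beta_2)}+x_{\beta_1\vee\beta_2}g_{(\alpha,\beta_1\wedge\beta_2)}+x_{\alpha\wedge\beta_2}g_{(\alpha\vee\beta_1,\beta_1\vee\beta_2)}.$$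 * If $\alpha\vee\beta_1\ne\alpha\vee\beta_2$, $\alpha\wedge\beta_1=\alpha\wedge\beta_2$, $\beta_1\nsim\beta_2$, $\beta_1\nsim\alpha\vee\beta_2$, $\beta_1\ge\alpha\wedge\beta_2$, $\beta_2\nsim\alpha\vee\beta_1$, $\beta_2\ge\alpha\wedge\beta_1$: $$G_1=x_{\beta_2}g_{(\alpha,\beta_1)}-x_{\beta_1}g_{(\alpha,\beta_2)}-x_{\alpha\wedge\beta_1}g_{(\beta_1,\alpha\vee\beta_2)}+x_{\alpha\wedge\beta_1}g_{(\beta_2,\alpha\vee\beta_1)}.$$ * If $\alpha\wedge\beta_1\ne\alpha\wedge\beta_2$, $\alpha\vee\beta_1=\alpha\vee\beta_2$, $\beta_1\nsim\beta_2$, $\beta_1\le\alpha\vee\beta_2$, $\beta_1\nsim\alpha\wedge\beta_2$, $\beta_2\le\alpha\vee\beta_1$, $\beta_2\nsim\alpha\wedge\beta_1$: $$G_2=x_{\beta_2}g_{(\alpha,\beta_1)}-x_{\beta_1}g_{(\alpha,\beta_2)}-x_{\alpha\vee\beta_1}g_{(\beta_1,\alpha\wedge\beta_2)}+x_{\alpha\vee\beta_1}g_{(\beta_2,\alpha\wedge\beta_1)}.$$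 In the remaining types $G_3,\dots,G_6,G$ one requires $\alpha\vee\beta_1\ne\alpha\vee\beta_2$, $\alpha\wedge\beta_1\ne\alpha\wedge\beta_2$, $\beta_1\nsim\beta_2$, and in addition: * If $\beta_1\le\alpha\vee\beta_2$, $\beta_1\nsim\alpha\wedge\beta_2$, $\beta_2\nsim\alpha\vee\beta_1$, $\beta_2\nsim\alpha\wedge\beta_1$: $$G_3=x_{\beta_2}g_{(\alpha,\beta_1)}-x_{\beta_1}g_{(\alpha,\beta_2)}-x_{\alpha\vee\beta_2}g_{(\beta_1,\alpha\wedge\beta_2)}+x_{\alpha\vee\beta_1}g_{(\beta_2,\alpha\wedge\beta_1)}+x_{\alpha\wedge\beta_1\wedge\beta_2}g_{(\alpha\vee\beta_1,\beta_1\vee\beta_2)}.$$ * If $\beta_1\nsim\alpha\vee\beta_2$, $\beta_1\ge\alpha\wedge\beta_2$, $\beta_2\nsim\alpha\vee\beta_1$, $\beta_2\nsim\alpha\wedge\beta_1$: $$G_4=x_{\beta_2}g_{(\alpha,\beta_1)}-x_{\beta_1}g_{(\alpha,\beta_2)}+x_{\alpha\wedge\beta_1}g_{(\beta_2,\alpha\vee\beta_1)}-x_{\alpha\wedge\beta_2}g_{(\beta_1,\alpha\vee\beta_2)}+x_{\alpha\vee\beta_1\vee\beta_2}g_{(\alpha\wedge\beta_1,\beta_1\wedge\beta_2)}.$$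 * If $\beta_1\nsim\alpha\vee\beta_2$, $\beta_1\nsim\alpha\wedge\beta_2$, $\beta_2\nsim\alpha\vee\beta_1$, $\beta_2\ge\alpha\wedge\beta_1$: $$G_5=x_{\beta_2}g_{(\alpha,\beta_1)}-x_{\beta_1}g_{(\alpha,\beta_2)}-x_{\alpha\vee\beta_2}g_{(\beta_1,\alpha\wedge\beta_2)}+x_{\alpha\wedge\beta_1}g_{(\beta_2,\alpha\vee\beta_1)}-x_{\alpha\wedge\beta_1}g_{(\beta_1\vee(\alpha\wedge\beta_2),\alpha\vee\beta_2)}.$$ * If $\beta_1\nsim\alpha\vee\beta_2$, $\beta_1\nsim\alpha\wedge\beta_2$, $\beta_2\le\alpha\vee\beta_1$, $\beta_2\nsim\alpha\wedge\beta_1$: $$G_6=x_{\beta_2}g_{(\alpha,\beta_1)}-x_{\beta_1}g_{(\alpha,\beta_2)}-x_{\alpha\vee\beta_2}g_{(\beta_1,\alpha\wedge\beta_2)}+x_{\alpha\vee\beta_1}g_{(\beta_2,\alpha\wedge\beta_1)}-x_{\alpha\wedge\beta_1\wedge\beta_2}g_{(\alpha\vee\beta_2,\beta_1\vee\beta_2)}.$$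 * If $\beta_1\nsim\alpha\vee\beta_2$, $\beta_1\nsim\alpha\wedge\beta_2$, $\beta_2\nsim\alpha\vee\beta_1$, $\beta_2\nsim\alpha\wedge\beta_1$: $$\begin{aligned}G={}&x_{\beta_2}g_{(\alpha,\beta_1)}-x_{\beta_1}g_{(\alpha,\beta_2)}-x_{\alpha\vee\beta_2}g_{(\beta_1,\alpha\wedge\beta_2)}+x_{\alpha\vee\beta_1}g_{(\beta_2,\alpha\wedge\beta_1)}\\&-x_{\alpha\wedge\beta_1\wedge\beta_2}g_{(\beta_1\vee(\alpha\wedge\beta_2),\alpha\vee\beta_2)}+x_{\alpha\wedge\beta_1\wedge\beta_2}g_{(\beta_2\vee(\alpha\wedge\beta_1),\alpha\vee\beta_1)}.\end{aligned}$$ * (Diamond type) For all $\alpha_1\nsim\beta_1$ and $\alpha_2\nsim\beta_2$ with $\alpha_1,\beta_1,\alpha_2,\beta_2$ distinct such that there are no $a,b\in\mathcal L$ with $a\wedge b=\beta_1$ and $a\vee b=\beta_2$: $$D=(x_{\alpha_2}x_{\beta_2}-x_{\alpha_2\vee\beta_2}x_{\alpha_2\wedge\beta_2})g_{(\alpha_1,\beta_1)}-(x_{\alpha_1}x_{\beta_1}-x_{\alpha_1\vee\beta_1}x_{\alpha_1\wedge\beta_1})g_{(\alpha_2,\beta_2)}.$$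 -/

import Mathlib

open MvPolynomial

namespace Hibi

/-- `a` and `b` are incomparable elements of the lattice. -/
abbrev Inc {L : Type*} [DistribLattice L] (a b : L) : Prop :=
  IncompRel (· ≤ ·) a b

/-- The polynomial `f_(a,b) = x_a x_b - x_{a ⊔ b} x_{a ⊓ b}`. -/
noncomputable def relation (K : Type*) {L : Type*} [Field K] [DistribLattice L] (a b : L) :
    MvPolynomial L K :=
  X a * X b - X (a ⊔ b) * X (a ⊓ b)

theorem relation_comm (K : Type*) {L : Type*} [Field K] [DistribLattice L] (a b : L) :
    relation K a b = relation K b a := by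
  unfold relation
  rw [mul_comm (X a) (X b), sup_comm, inf_comm]

/-- The ideal `I_L` generated by the diamond relations. -/
noncomputable def hibiIdeal (K L : Type*) [Field K] [DistribLattice L] : Ideal (MvPolynomial L K) :=
  Ideal.span {p | ∃ a b : L, Inc a b ∧ p = relation K a b}

/-- The Hibi ring `R[L] = K[L] / I_L`. -/
abbrev HibiRing (K L : Type*) [Field K] [DistribLattice L] : Type _ :=
  MvPolynomial L K ⧸ hibiIdeal K L

/-- The diamonds of `L`: unordered pairs of incomparable elements. -/
def Diamond (L : Type*) [DistribLattice L] : Type _ :=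
  {s : Sym2 L // s ∈ Sym2.fromRel (r := fun a b : L => Inc a b) ⟨fun _ _ h => h.symm⟩}

/-- The diamond relation attached to a diamond. -/
noncomputable def diamondRelation (K : Type*) {L : Type*} [Field K] [DistribLattice L]
    (d : Diamond L) : MvPolynomial L K :=
  Sym2.lift ⟨fun a b => relation K a b, relation_comm K⟩ d.1

/-- The free `K[L]`-module with one basis element for each diamond. -/
abbrev FreeMod (K L : Type*) [Field K] [DistribLattice L] : Type _ :=
  Diamond L →₀ MvPolynomial L K

/-- The map `φ` from the free module to `K[L]`, sending the basis element of a diamond to its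
diamond relation. -/
noncomputable def phi (K L : Type*) [Field K] [DistribLattice L] :
    FreeMod K L →ₗ[MvPolynomial L K] MvPolynomial L K :=
  Finsupp.linearCombination (MvPolynomial L K) (diamondRelation K)

/-- The image of `φ` is `I_L`, so that `φ` is the beginning of a free resolution of the
Hibi ring. -/
theorem range_phi (K L : Type*) [Field K] [DistribLattice L] :
    LinearMap.range (phi K L) = hibiIdeal K L := by
  unfold phi hibiIdeal Ideal.span
  rw [Finsupp.range_linearCombination]
  congr 1
  ext p
  constructor
  · rintro ⟨⟨s, hs⟩, rfl⟩
    induction s using Sym2.ind with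
    | _ a b => exact ⟨a, b, hs, rfl⟩
  · rintro ⟨a, b, h, rfl⟩
    exact ⟨⟨s(a, b), h⟩, rfl⟩

/-- The first syzygy module of the Hibi ring: the kernel of `φ`. -/
noncomputable def firstSyzygy (K L : Type*) [Field K] [DistribLattice L] :
    Submodule (MvPolynomial L K) (FreeMod K L) :=
  LinearMap.ker (phi K L)

/-- The variable `x_a` of `K[L]`. -/
noncomputable def x (K : Type*) {L : Type*} [Field K] (a : L) : MvPolynomial L K := X a

open Classical in
/-- The basis element `g_(a,b)` of the free module attached to the diamond `(a, b)`. If `a` and `b`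
are comparable there is no diamond, `f_(a,b) = 0`, and `g_(a,b)` is understood to be `0`. -/
noncomputable def g (K : Type*) {L : Type*} [Field K] [DistribLattice L] (a b : L) :
    FreeMod K L :=
  if h : Inc a b then Finsupp.single ⟨s(a, b), h⟩ 1 else 0

section types

variable (K L : Type*) [Field K] [DistribLattice L]

/-- Strip type 1. -/
def typeS1 : Set (FreeMod K L) :=
  {s | ∃ α β₁ β₂ : L, Inc α β₁ ∧ Inc α β₂ ∧
    α ⊔ β₁ ≠ α ⊔ β₂ ∧ α ⊓ β₁ = α ⊓ β₂ ∧ β₁ ≤ β₂ ∧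
    β₁ ≤ α ⊔ β₂ ∧ α ⊓ β₂ ≤ β₁ ∧ Inc β₂ (α ⊔ β₁) ∧ α ⊓ β₁ ≤ β₂ ∧
    s = -x K β₂ • g K α β₁ + x K β₁ • g K α β₂ - x K (α ⊓ β₁) • g K β₂ (α ⊔ β₁)}

/-- Strip type 2. -/
def typeS2 : Set (FreeMod K L) :=
  {s | ∃ α β₁ β₂ : L, Inc α β₁ ∧ Inc α β₂ ∧
    α ⊔ β₁ ≠ α ⊔ β₂ ∧ α ⊓ β₁ = α ⊓ β₂ ∧ β₁ ≤ β₂ ∧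
    β₁ ≤ α ⊔ β₂ ∧ α ⊓ β₂ ≤ β₁ ∧ Inc β₂ (α ⊔ β₁) ∧ α ⊓ β₁ ≤ β₂ ∧
    s = x K (α ⊔ β₂) • g K α β₁ - x K (α ⊔ β₁) • g K α β₂ + x K α • g K β₂ (α ⊔ β₁)}

/-- `L`-type. -/
def typeL : Set (FreeMod K L) :=
  {s | ∃ α β₁ β₂ : L, Inc α β₁ ∧ Inc α β₂ ∧
    α ⊓ β₁ ≠ α ⊓ β₂ ∧ α ⊔ β₁ ≠ α ⊔ β₂ ∧ β₁ ≤ β₂ ∧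
    β₁ ≤ α ⊔ β₂ ∧ Inc β₁ (α ⊓ β₂) ∧ Inc β₂ (α ⊔ β₁) ∧ α ⊓ β₁ ≤ β₂ ∧
    s = -x K β₂ • g K α β₁ + x K β₁ • g K α β₂
      + x K (α ⊔ β₂) • g K β₁ (α ⊓ β₂) - x K (α ⊓ β₁) • g K β₂ (α ⊔ β₁)}

/-- Box type 1. -/
def typeB1 : Set (FreeMod K L) :=
  {s | ∃ α β₁ β₂ : L, Inc α β₁ ∧ Inc α β₂ ∧
    α ⊓ β₁ ≠ α ⊓ β₂ ∧ α ⊔ β₁ ≠ α ⊔ β₂ ∧ Inc β₁ β₂ ∧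
    β₁ ≤ α ⊔ β₂ ∧ α ⊓ β₂ ≤ β₁ ∧ Inc β₂ (α ⊔ β₁) ∧ Inc β₂ (α ⊓ β₁) ∧
    s = -x K β₂ • g K α β₁ + x K β₁ • g K α β₂
      - x K (α ⊔ β₁) • g K β₂ (α ⊓ β₁) - x K (α ⊓ β₂) • g K (α ⊔ β₁) (β₁ ⊔ β₂)}

/-- Box type 2. -/
def typeB2 : Set (FreeMod K L) :=
  {s | ∃ α β₁ β₂ : L, Inc α β₁ ∧ Inc α β₂ ∧
    α ⊓ β₁ ≠ α ⊓ β₂ ∧ α ⊔ β₁ ≠ α ⊔ β₂ ∧ Inc β₁ β₂ ∧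
    β₁ ≤ α ⊔ β₂ ∧ α ⊓ β₂ ≤ β₁ ∧ Inc β₂ (α ⊔ β₁) ∧ Inc β₂ (α ⊓ β₁) ∧
    s = -x K β₁ • g K α β₂ + x K α • g K β₁ β₂
      + x K (β₁ ⊔ β₂) • g K α (β₁ ⊓ β₂) + x K (α ⊓ β₂) • g K (α ⊔ β₁) (β₁ ⊔ β₂)}

/-- Type `G₁`. -/
def typeG1 : Set (FreeMod K L) :=
  {s | ∃ α β₁ β₂ : L, Inc α β₁ ∧ Inc α β₂ ∧
    α ⊔ β₁ ≠ α ⊔ β₂ ∧ α ⊓ β₁ = α ⊓ β₂ ∧ Inc β₁ β₂ ∧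
    Inc β₁ (α ⊔ β₂) ∧ α ⊓ β₂ ≤ β₁ ∧ Inc β₂ (α ⊔ β₁) ∧ α ⊓ β₁ ≤ β₂ ∧
    s = x K β₂ • g K α β₁ - x K β₁ • g K α β₂
      - x K (α ⊓ β₁) • g K β₁ (α ⊔ β₂) + x K (α ⊓ β₁) • g K β₂ (α ⊔ β₁)}

/-- Type `G₂`. -/
def typeG2 : Set (FreeMod K L) :=
  {s | ∃ α β₁ β₂ : L, Inc α β₁ ∧ Inc α β₂ ∧
    α ⊓ β₁ ≠ α ⊓ β₂ ∧ α ⊔ β₁ = α ⊔ β₂ ∧ Inc β₁ β₂ ∧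
    β₁ ≤ α ⊔ β₂ ∧ Inc β₁ (α ⊓ β₂) ∧ β₂ ≤ α ⊔ β₁ ∧ Inc β₂ (α ⊓ β₁) ∧
    s = x K β₂ • g K α β₁ - x K β₁ • g K α β₂
      - x K (α ⊔ β₁) • g K β₁ (α ⊓ β₂) + x K (α ⊔ β₁) • g K β₂ (α ⊓ β₁)}

/-- Type `G₃`. -/
def typeG3 : Set (FreeMod K L) :=
  {s | ∃ α β₁ β₂ : L, Inc α β₁ ∧ Inc α β₂ ∧
    α ⊔ β₁ ≠ α ⊔ β₂ ∧ α ⊓ β₁ ≠ α ⊓ β₂ ∧ Inc β₁ β₂ ∧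
    β₁ ≤ α ⊔ β₂ ∧ Inc β₁ (α ⊓ β₂) ∧ Inc β₂ (α ⊔ β₁) ∧ Inc β₂ (α ⊓ β₁) ∧
    s = x K β₂ • g K α β₁ - x K β₁ • g K α β₂
      - x K (α ⊔ β₂) • g K β₁ (α ⊓ β₂) + x K (α ⊔ β₁) • g K β₂ (α ⊓ β₁)
      + x K (α ⊓ β₁ ⊓ β₂) • g K (α ⊔ β₁) (β₁ ⊔ β₂)}

/-- Type `G₄`. -/
def typeG4 : Set (FreeMod K L) :=
  {s | ∃ α β₁ β₂ : L, Inc α β₁ ∧ Inc α β₂ ∧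
    α ⊔ β₁ ≠ α ⊔ β₂ ∧ α ⊓ β₁ ≠ α ⊓ β₂ ∧ Inc β₁ β₂ ∧
    Inc β₁ (α ⊔ β₂) ∧ α ⊓ β₂ ≤ β₁ ∧ Inc β₂ (α ⊔ β₁) ∧ Inc β₂ (α ⊓ β₁) ∧
    s = x K β₂ • g K α β₁ - x K β₁ • g K α β₂
      + x K (α ⊓ β₁) • g K β₂ (α ⊔ β₁) - x K (α ⊓ β₂) • g K β₁ (α ⊔ β₂)
      + x K (α ⊔ β₁ ⊔ β₂) • g K (α ⊓ β₁) (β₁ ⊓ β₂)}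

/-- Type `G₅`. -/
def typeG5 : Set (FreeMod K L) :=
  {s | ∃ α β₁ β₂ : L, Inc α β₁ ∧ Inc α β₂ ∧
    α ⊔ β₁ ≠ α ⊔ β₂ ∧ α ⊓ β₁ ≠ α ⊓ β₂ ∧ Inc β₁ β₂ ∧
    Inc β₁ (α ⊔ β₂) ∧ Inc β₁ (α ⊓ β₂) ∧ Inc β₂ (α ⊔ β₁) ∧ α ⊓ β₁ ≤ β₂ ∧
    s = x K β₂ • g K α β₁ - x K β₁ • g K α β₂
      - x K (α ⊔ β₂) • g K β₁ (α ⊓ β₂) + x K (α ⊓ β₁) • g K β₂ (α ⊔ β₁)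
      - x K (α ⊓ β₁) • g K (β₁ ⊔ (α ⊓ β₂)) (α ⊔ β₂)}

/-- Type `G₆`. -/
def typeG6 : Set (FreeMod K L) :=
  {s | ∃ α β₁ β₂ : L, Inc α β₁ ∧ Inc α β₂ ∧
    α ⊔ β₁ ≠ α ⊔ β₂ ∧ α ⊓ β₁ ≠ α ⊓ β₂ ∧ Inc β₁ β₂ ∧
    Inc β₁ (α ⊔ β₂) ∧ Inc β₁ (α ⊓ β₂) ∧ β₂ ≤ α ⊔ β₁ ∧ Inc β₂ (α ⊓ β₁) ∧
    s = x K β₂ • g K α β₁ - x K β₁ • g K α β₂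
      - x K (α ⊔ β₂) • g K β₁ (α ⊓ β₂) + x K (α ⊔ β₁) • g K β₂ (α ⊓ β₁)
      - x K (α ⊓ β₁ ⊓ β₂) • g K (α ⊔ β₂) (β₁ ⊔ β₂)}

/-- Type `G`. -/
def typeG : Set (FreeMod K L) :=
  {s | ∃ α β₁ β₂ : L, Inc α β₁ ∧ Inc α β₂ ∧
    α ⊔ β₁ ≠ α ⊔ β₂ ∧ α ⊓ β₁ ≠ α ⊓ β₂ ∧ Inc β₁ β₂ ∧
    Inc β₁ (α ⊔ β₂) ∧ Inc β₁ (α ⊓ β₂) ∧ Inc β₂ (α ⊔ β₁) ∧ Inc β₂ (α ⊓ β₁) ∧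
    s = x K β₂ • g K α β₁ - x K β₁ • g K α β₂
      - x K (α ⊔ β₂) • g K β₁ (α ⊓ β₂) + x K (α ⊔ β₁) • g K β₂ (α ⊓ β₁)
      - x K (α ⊓ β₁ ⊓ β₂) • g K (β₁ ⊔ (α ⊓ β₂)) (α ⊔ β₂)
      + x K (α ⊓ β₁ ⊓ β₂) • g K (β₂ ⊔ (α ⊓ β₁)) (α ⊔ β₁)}

/-- Diamond type. -/
def typeD : Set (FreeMod K L) :=
  {s | ∃ α₁ β₁ α₂ β₂ : L, Inc α₁ β₁ ∧ Inc α₂ β₂ ∧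
    α₁ ≠ α₂ ∧ α₁ ≠ β₂ ∧ β₁ ≠ α₂ ∧ β₁ ≠ β₂ ∧
    (¬ ∃ a b : L, a ⊓ b = β₁ ∧ a ⊔ b = β₂) ∧
    s = (x K α₂ * x K β₂ - x K (α₂ ⊔ β₂) * x K (α₂ ⊓ β₂)) • g K α₁ β₁
      - (x K α₁ * x K β₁ - x K (α₁ ⊔ β₁) * x K (α₁ ⊓ β₁)) • g K α₂ β₂}

end types

end Hibi

namespace Hibi

/-! ### The listed elements are syzygies. -/

section Soundness

variable {K L : Type*} [Field K] [DistribLattice L]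

/-! This is a Gröbner-style argument with a weight in place of a monomial order. Give `x_a` the
weight `height a`. Submodularity of `height`, strict on incomparable pairs, makes `x_a x_b` the
unique term of top weight in each diamond relation (`height_sup_add_inf_lt`).

The two-term syzygies of these leading monomials are monomial multiples of S-pairs: critical ones
when two diamonds share an element (`sPair_mem`), Koszul ones when they are disjoint (`koszul_mem`).
Each S-pair is, up to sign, a listed syzygy plus terms of smaller weight. Hence terms `m • g_(a,b)`
with the same leading monomial agree modulo the listed syzygies and smaller weight
(`monomial_smul_g_sub_mem`).

In an element of the kernel the top-weight parts of the images cancel, so its top-weight part lies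
in the listed span up to smaller weight (`sub_liftTop_phi_mem`). Subtracting a listed combination
lowers the weight and stays in the kernel, and the descent ends at `0`. Types `B₂`, `G₅` and `G₆`
are needed only for the inclusion in the kernel; the other types already generate it. -/

theorem g_comm (a b : L) : g K a b = g K b a := by
  unfold g
  by_cases h : Inc a b
  · rw [dif_pos h, dif_pos h.symm]
    congr 2
    exact Sym2.eq_swap
  · rw [dif_neg h, dif_neg fun h' => h h'.symm]

theorem g_eq_zero {a b : L} (h : ¬ Inc a b) : g K a b = 0 := by
  rw [g, dif_neg h]

theorem relation_eq_zero {a b : L} (h : ¬ Inc a b) : relation K a b = 0 := by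
  have h' : a ≤ b ∨ b ≤ a := by
    by_contra! hc
    exact h ⟨hc.1, hc.2⟩
  unfold relation
  rcases h' with h' | h'
  · rw [sup_eq_right.2 h', inf_eq_left.2 h']; ring
  · rw [sup_eq_left.2 h', inf_eq_right.2 h']; ring

theorem phi_g (a b : L) : phi K L (g K a b) = x K a * x K b - x K (a ⊔ b) * x K (a ⊓ b) := by
  change _ = relation K a b
  by_cases h : Inc a b
  · rw [g, dif_pos h]
    exact (Finsupp.linearCombination_single _ _ _).trans (one_smul _ _)
  · rw [g_eq_zero h, relation_eq_zero h, map_zero]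

theorem typeS1_le : typeS1 K L ⊆ firstSyzygy K L := by
  rintro _ ⟨α, β₁, β₂, -, -, -, h, h12, -, -, -, -, rfl⟩
  have e1 : β₂ ⊔ (α ⊔ β₁) = α ⊔ β₂ := by rw [sup_left_comm, sup_eq_left.2 h12]
  have e2 : β₂ ⊓ (α ⊔ β₁) = β₁ := by
    rw [inf_sup_left, inf_comm β₂ α, ← h, inf_eq_right.2 h12, sup_eq_right]
    exact inf_le_right
  simp only [SetLike.mem_coe, firstSyzygy, LinearMap.mem_ker, map_sub, map_add, map_smul,
    smul_eq_mul, phi_g, e1, e2, ← h]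
  ring

theorem typeS2_le : typeS2 K L ⊆ firstSyzygy K L := by
  rintro _ ⟨α, β₁, β₂, -, -, -, h, h12, -, -, -, -, rfl⟩
  have e1 : β₂ ⊔ (α ⊔ β₁) = α ⊔ β₂ := by rw [sup_left_comm, sup_eq_left.2 h12]
  have e2 : β₂ ⊓ (α ⊔ β₁) = β₁ := by
    rw [inf_sup_left, inf_comm β₂ α, ← h, inf_eq_right.2 h12, sup_eq_right]
    exact inf_le_right
  simp only [SetLike.mem_coe, firstSyzygy, LinearMap.mem_ker, map_sub, map_add, map_smul,
    smul_eq_mul, phi_g, e1, e2, ← h]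
  ring

theorem typeL_le : typeL K L ⊆ firstSyzygy K L := by
  rintro _ ⟨α, β₁, β₂, -, -, -, -, h12, -, -, -, -, rfl⟩
  have e1 : β₂ ⊔ (α ⊔ β₁) = α ⊔ β₂ := by rw [sup_left_comm, sup_eq_left.2 h12]
  have e2 : β₂ ⊓ (α ⊔ β₁) = β₁ ⊔ (α ⊓ β₂) := by
    rw [inf_sup_left, inf_comm β₂ α, inf_eq_right.2 h12, sup_comm]
  have e3 : β₁ ⊓ (α ⊓ β₂) = α ⊓ β₁ := by rw [inf_left_comm, inf_eq_left.2 h12]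
  simp only [SetLike.mem_coe, firstSyzygy, LinearMap.mem_ker, map_sub, map_add, map_smul,
    smul_eq_mul, phi_g, e1, e2, e3]
  ring

theorem typeB1_le : typeB1 K L ⊆ firstSyzygy K L := by
  rintro _ ⟨α, β₁, β₂, -, -, -, -, -, h1, h2, -, -, rfl⟩
  have e1 : β₂ ⊔ (α ⊓ β₁) = β₁ ⊔ β₂ := by
    rw [sup_inf_left, sup_comm β₂ α, sup_comm β₂ β₁]
    exact inf_eq_right.2 (sup_le h1 le_sup_right)
  have e2 : β₂ ⊓ (α ⊓ β₁) = α ⊓ β₂ := by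
    rw [inf_comm, inf_right_comm, inf_eq_left.2 h2]
  have e3 : α ⊔ β₁ ⊔ (β₁ ⊔ β₂) = α ⊔ β₂ := by
    exact le_antisymm (sup_le (sup_le le_sup_left h1) (sup_le h1 le_sup_right))
      (sup_le (le_sup_left.trans le_sup_left) (le_sup_right.trans le_sup_right))
  have e4 : (α ⊔ β₁) ⊓ (β₁ ⊔ β₂) = β₁ := by
    rw [sup_comm α, ← sup_inf_left, sup_eq_left.2 h2]
  simp only [SetLike.mem_coe, firstSyzygy, LinearMap.mem_ker, map_sub, map_add, map_smul,
    smul_eq_mul, phi_g, e1, e2, e3, e4]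
  ring

theorem typeB2_le : typeB2 K L ⊆ firstSyzygy K L := by
  rintro _ ⟨α, β₁, β₂, -, -, -, -, -, h1, h2, -, -, rfl⟩
  have e1 : α ⊔ (β₁ ⊓ β₂) = α ⊔ β₁ := by
    rw [sup_inf_left]
    exact inf_eq_left.2 (sup_le le_sup_left h1)
  have e2 : α ⊓ (β₁ ⊓ β₂) = α ⊓ β₂ := by
    rw [inf_left_comm, inf_eq_right.2 h2]
  have e3 : α ⊔ β₁ ⊔ (β₁ ⊔ β₂) = α ⊔ β₂ := by
    exact le_antisymm (sup_le (sup_le le_sup_left h1) (sup_le h1 le_sup_right))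
      (sup_le (le_sup_left.trans le_sup_left) (le_sup_right.trans le_sup_right))
  have e4 : (α ⊔ β₁) ⊓ (β₁ ⊔ β₂) = β₁ := by
    rw [sup_comm α, ← sup_inf_left, sup_eq_left.2 h2]
  simp only [SetLike.mem_coe, firstSyzygy, LinearMap.mem_ker, map_add, map_smul,
    smul_eq_mul, phi_g, e1, e2, e3, e4]
  ring

theorem typeG1_le : typeG1 K L ⊆ firstSyzygy K L := by
  rintro _ ⟨α, β₁, β₂, -, -, -, h, -, -, -, -, -, rfl⟩
  have e1 : β₁ ⊔ (α ⊔ β₂) = β₂ ⊔ (α ⊔ β₁) := by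
    rw [sup_left_comm, sup_comm β₁, sup_left_comm]
  have e2 : β₁ ⊓ (α ⊔ β₂) = β₂ ⊓ (α ⊔ β₁) := by
    rw [inf_sup_left, inf_sup_left, inf_comm _ α, inf_comm _ α, h, inf_comm β₁]
  simp only [SetLike.mem_coe, firstSyzygy, LinearMap.mem_ker, map_sub, map_add, map_smul,
    smul_eq_mul, phi_g, e1, e2, ← h]
  ring

theorem typeG2_le : typeG2 K L ⊆ firstSyzygy K L := by
  rintro _ ⟨α, β₁, β₂, -, -, -, h, -, -, -, -, -, rfl⟩
  have e1 : β₁ ⊓ (α ⊓ β₂) = β₂ ⊓ (α ⊓ β₁) := by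
    rw [inf_left_comm, inf_comm β₁, inf_left_comm]
  have e2 : β₁ ⊔ (α ⊓ β₂) = β₂ ⊔ (α ⊓ β₁) := by
    rw [sup_inf_left, sup_inf_left, sup_comm _ α, sup_comm _ α, h, sup_comm β₁]
  simp only [SetLike.mem_coe, firstSyzygy, LinearMap.mem_ker, map_sub, map_add, map_smul,
    smul_eq_mul, phi_g, e1, e2, ← h]
  ring

/-- The first four terms are common to `G₃`, `G₆` and `G`. What they leave is `x_{α ⊓ β₁ ⊓ β₂}`
times a difference of two quadratic monomials. That difference is plus or minus one diamond relation
for `G₃` and `G₆`, and a difference of two such relations for `G`. -/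
theorem phi_sPair_add (α β₁ β₂ : L) :
    x K β₂ * phi K L (g K α β₁) - x K β₁ * phi K L (g K α β₂)
      - x K (α ⊔ β₂) * phi K L (g K β₁ (α ⊓ β₂)) + x K (α ⊔ β₁) * phi K L (g K β₂ (α ⊓ β₁)) =
    x K (α ⊓ β₁ ⊓ β₂) * (x K (β₁ ⊔ α ⊓ β₂) * x K (α ⊔ β₂) - x K (β₂ ⊔ α ⊓ β₁) * x K (α ⊔ β₁)) := by
  have e1 : β₁ ⊓ (α ⊓ β₂) = α ⊓ β₁ ⊓ β₂ := by rw [inf_left_comm, inf_assoc]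
  have e2 : β₂ ⊓ (α ⊓ β₁) = α ⊓ β₁ ⊓ β₂ := by rw [inf_comm]
  simp only [phi_g, e1, e2]
  ring

theorem typeG3_le : typeG3 K L ⊆ firstSyzygy K L := by
  rintro _ ⟨α, β₁, β₂, -, -, -, -, -, h1, -, -, -, rfl⟩
  have e1 : β₂ ⊔ (α ⊓ β₁) = β₁ ⊔ β₂ := by
    rw [sup_inf_left, sup_comm β₂ α, sup_comm β₂ β₁]
    exact inf_eq_right.2 (sup_le h1 le_sup_right)
  have e3 : α ⊔ β₁ ⊔ (β₁ ⊔ β₂) = α ⊔ β₂ := by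
    exact le_antisymm (sup_le (sup_le le_sup_left h1) (sup_le h1 le_sup_right))
      (sup_le (le_sup_left.trans le_sup_left) (le_sup_right.trans le_sup_right))
  have e4 : (α ⊔ β₁) ⊓ (β₁ ⊔ β₂) = β₁ ⊔ (α ⊓ β₂) := by
    rw [sup_comm α, ← sup_inf_left]
  simp only [SetLike.mem_coe, firstSyzygy, LinearMap.mem_ker, map_sub, map_add, map_smul,
    smul_eq_mul, phi_sPair_add]
  rw [phi_g, e1, e3, e4]
  ring

theorem typeG6_le : typeG6 K L ⊆ firstSyzygy K L := by
  rintro _ ⟨α, β₁, β₂, -, -, -, -, -, -, -, h1, -, rfl⟩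
  have e1 : β₁ ⊔ (α ⊓ β₂) = β₁ ⊔ β₂ := by
    rw [sup_inf_left, sup_comm β₁ α]
    exact inf_eq_right.2 (sup_le le_sup_right h1)
  have e3 : α ⊔ β₂ ⊔ (β₁ ⊔ β₂) = α ⊔ β₁ := by
    rw [sup_sup_sup_comm, sup_idem, sup_eq_left.2 h1]
  have e4 : (α ⊔ β₂) ⊓ (β₁ ⊔ β₂) = β₂ ⊔ (α ⊓ β₁) := by
    rw [← sup_inf_right, sup_comm]
  simp only [SetLike.mem_coe, firstSyzygy, LinearMap.mem_ker, map_sub, map_add, map_smul,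
    smul_eq_mul, phi_sPair_add]
  rw [phi_g, e1, e3, e4]
  ring

theorem typeG4_le : typeG4 K L ⊆ firstSyzygy K L := by
  rintro _ ⟨α, β₁, β₂, -, -, -, -, -, -, h1, -, -, rfl⟩
  have e1 : β₂ ⊔ (α ⊔ β₁) = α ⊔ β₁ ⊔ β₂ := sup_comm _ _
  have e2 : β₁ ⊔ (α ⊔ β₂) = α ⊔ β₁ ⊔ β₂ := by rw [sup_left_comm, sup_assoc]
  have e3 : β₂ ⊓ (α ⊔ β₁) = β₁ ⊓ β₂ := by
    rw [inf_sup_left, inf_comm β₂ α, inf_comm β₂ β₁]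
    exact sup_eq_right.2 (le_inf h1 inf_le_right)
  have e4 : α ⊓ β₁ ⊓ (β₁ ⊓ β₂) = α ⊓ β₂ := by
    exact le_antisymm
      (le_inf (inf_le_left.trans inf_le_left) (inf_le_right.trans inf_le_right))
      (le_inf (le_inf inf_le_left h1) (le_inf h1 inf_le_right))
  have e5 : α ⊓ β₁ ⊔ β₁ ⊓ β₂ = β₁ ⊓ (α ⊔ β₂) := by rw [inf_sup_left, inf_comm α]
  simp only [SetLike.mem_coe, firstSyzygy, LinearMap.mem_ker, map_sub, map_add, map_smul,
    smul_eq_mul, phi_g, e1, e2, e3, e4, e5]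
  ring

theorem median_sup (α β₁ β₂ : L) : β₁ ⊔ α ⊓ β₂ ⊔ (α ⊔ β₂) = α ⊔ β₁ ⊔ β₂ := by
  apply le_antisymm
  · exact sup_le (sup_le (le_sup_right.trans le_sup_left)
      (inf_le_left.trans (le_sup_left.trans le_sup_left)))
      (sup_le (le_sup_left.trans le_sup_left) le_sup_right)
  · exact sup_le (sup_le (le_sup_left.trans le_sup_right) (le_sup_left.trans le_sup_left))
      (le_sup_right.trans le_sup_right)

/-- The right side is the median, symmetric in the three elements. In type `G` the two correcting
diamonds therefore have the same join and the same meet, so their lower terms cancel. -/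
theorem median_inf (α β₁ β₂ : L) :
    (β₁ ⊔ α ⊓ β₂) ⊓ (α ⊔ β₂) = (α ⊓ β₁) ⊔ (α ⊓ β₂) ⊔ (β₁ ⊓ β₂) := by
  rw [inf_sup_right, inf_sup_left, inf_eq_left.2 (inf_le_left.trans le_sup_left : α ⊓ β₂ ≤ α ⊔ β₂),
    inf_comm β₁ α, sup_right_comm]

theorem typeG5_le : typeG5 K L ⊆ firstSyzygy K L := by
  rintro _ ⟨α, β₁, β₂, -, -, -, -, -, -, -, -, h1, rfl⟩
  have e1 : β₂ ⊔ (α ⊔ β₁) = α ⊔ β₁ ⊔ β₂ := sup_comm _ _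
  have e2 : β₁ ⊓ (α ⊓ β₂) = α ⊓ β₁ := by
    rw [inf_left_comm, ← inf_assoc, inf_eq_left.2 h1]
  have e3 : β₂ ⊓ (α ⊔ β₁) = (α ⊓ β₁) ⊔ (α ⊓ β₂) ⊔ (β₁ ⊓ β₂) := by
    rw [inf_sup_left, inf_comm β₂ α, inf_comm β₂ β₁, sup_assoc]
    exact (sup_eq_right.2 ((le_inf inf_le_right h1).trans le_sup_right)).symm
  simp only [SetLike.mem_coe, firstSyzygy, LinearMap.mem_ker, map_sub, map_add, map_smul,
    smul_eq_mul, phi_g, e1, e2, e3, median_sup, median_inf]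
  ring

theorem typeG_le : typeG K L ⊆ firstSyzygy K L := by
  rintro _ ⟨α, β₁, β₂, -, -, -, -, -, -, -, -, -, rfl⟩
  have e1 : (α ⊓ β₂) ⊔ (α ⊓ β₁) ⊔ (β₂ ⊓ β₁) = (α ⊓ β₁) ⊔ (α ⊓ β₂) ⊔ (β₁ ⊓ β₂) := by
    rw [sup_comm (α ⊓ β₂), inf_comm β₂]
  simp only [SetLike.mem_coe, firstSyzygy, LinearMap.mem_ker, map_sub, map_add, map_smul,
    smul_eq_mul, phi_sPair_add]
  rw [phi_g, phi_g, median_sup, median_inf, median_sup, median_inf, e1, sup_right_comm α β₂]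
  ring

theorem typeD_le : typeD K L ⊆ firstSyzygy K L := by
  rintro _ ⟨α₁, β₁, α₂, β₂, -, -, -, -, -, -, -, rfl⟩
  simp only [SetLike.mem_coe, firstSyzygy, LinearMap.mem_ker, map_sub, map_smul, smul_eq_mul,
    phi_g]
  ring

variable (K L) in
/-- The submodule generated by the syzygies of all the listed types. -/
noncomputable def typeSpan : Submodule (MvPolynomial L K) (FreeMod K L) :=
  Submodule.span (MvPolynomial L K)
    (typeS1 K L ∪ typeS2 K L ∪ typeL K L ∪ typeB1 K L ∪ typeB2 K L ∪ typeG1 K L ∪ typeG2 K L ∪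
      typeG3 K L ∪ typeG4 K L ∪ typeG5 K L ∪ typeG6 K L ∪ typeG K L ∪ typeD K L)

theorem typeSpan_le : typeSpan K L ≤ firstSyzygy K L := by
  rw [typeSpan, Submodule.span_le]
  simp only [Set.union_subset_iff]
  exact ⟨⟨⟨⟨⟨⟨⟨⟨⟨⟨⟨⟨typeS1_le, typeS2_le⟩, typeL_le⟩, typeB1_le⟩, typeB2_le⟩, typeG1_le⟩,
    typeG2_le⟩, typeG3_le⟩, typeG4_le⟩, typeG5_le⟩, typeG6_le⟩, typeG_le⟩, typeD_le⟩

end Soundness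

end Hibi

namespace Hibi

/-! ### The weight filtration, and critical pairs with comparable `β₁`, `β₂`. -/

section Filtration

variable {K L : Type*} [Field K] [DistribLattice L]

/-- The number of elements not below `a`: a weight for which replacing an incomparable pair by its
join and meet is strictly decreasing. -/
noncomputable def height (a : L) : ℕ := {y : L | ¬ y ≤ a}.ncard

theorem height_union (a b : L) : {y : L | ¬ y ≤ a} ∪ {y | ¬ y ≤ b} = {y | ¬ y ≤ a ⊓ b} := by
  ext y
  simp only [Set.mem_union, Set.mem_ofPred_eq, le_inf_iff]
  tauto

theorem subset_inter_not_le (a b : L) :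
    {y : L | ¬ y ≤ a ⊔ b} ⊆ {y : L | ¬ y ≤ a} ∩ {y | ¬ y ≤ b} :=
  fun _ hy => ⟨fun h => hy (h.trans le_sup_left), fun h => hy (h.trans le_sup_right)⟩

/-- The complements of the down-sets of `a` and `b` have as union exactly that of `a ⊓ b`, while
their intersection contains that of `a ⊔ b`; by incomparability it also contains the extra point `a
⊔ b`. -/
theorem height_sup_add_inf_lt [Finite L] {a b : L} (h : Inc a b) :
    height (a ⊔ b) + height (a ⊓ b) < height a + height b := by
  have h1 := Set.ncard_union_add_ncard_inter {y : L | ¬ y ≤ a} {y | ¬ y ≤ b}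
  rw [height_union] at h1
  have h2 : {y : L | ¬ y ≤ a ⊔ b}.ncard < ({y : L | ¬ y ≤ a} ∩ {y | ¬ y ≤ b}).ncard := by
    refine Set.ncard_lt_ncard ⟨subset_inter_not_le a b, fun hs => ?_⟩
    have : a ⊔ b ∈ {y : L | ¬ y ≤ a} ∩ {y | ¬ y ≤ b} :=
      ⟨fun h' => h.2 (le_sup_right.trans h'), fun h' => h.1 (le_sup_left.trans h')⟩
    exact hs this le_rfl
  unfold height
  omega

theorem height_sup_add_inf_le [Finite L] (a b : L) :
    height (a ⊔ b) + height (a ⊓ b) ≤ height a + height b := by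
  have h1 := Set.ncard_union_add_ncard_inter {y : L | ¬ y ≤ a} {y | ¬ y ≤ b}
  rw [height_union] at h1
  have h2 := Set.ncard_le_ncard (subset_inter_not_le a b)
  unfold height
  omega

/-- The weight of a monomial. -/
noncomputable def wt : (L →₀ ℕ) →+ ℕ := Finsupp.weight height

theorem wt_single (a : L) : wt (Finsupp.single a 1) = height a := by
  rw [wt, Finsupp.weight_single, one_smul]

variable (K L) in
/-- The span of the terms `m • g_(a,b)` with `m x_a x_b` of weight less than `n`. -/
noncomputable def lower (n : ℕ) : Submodule K (FreeMod K L) :=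
  Submodule.span K {s | ∃ (u : L →₀ ℕ) (a b : L), wt u + height a + height b < n ∧
    s = monomial u (1 : K) • g K a b}

theorem monomial_smul_mem_lower {n : ℕ} {s : FreeMod K L} (hs : s ∈ lower K L n) (v : L →₀ ℕ) :
    monomial v (1 : K) • s ∈ lower K L (n + wt v) := by
  induction hs using Submodule.span_induction with
  | mem s h =>
    obtain ⟨u, a, b, h, rfl⟩ := h
    refine Submodule.subset_span ⟨v + u, a, b, ?_, ?_⟩
    · rw [map_add]; omega
    · rw [smul_smul, monomial_mul, one_mul]
  | zero => rw [smul_zero]; exact zero_mem _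
  | add s t _ _ hs ht => rw [smul_add]; exact add_mem hs ht
  | smul c s _ hs => rw [smul_comm]; exact Submodule.smul_mem _ c hs

theorem x_smul_g_mem_lower {n : ℕ} {a b c : L}
    (h : Inc a b → height c + height a + height b < n) : x K c • g K a b ∈ lower K L n := by
  by_cases hab : Inc a b
  · exact Submodule.subset_span ⟨Finsupp.single c 1, a, b, by rw [wt_single]; exact h hab, rfl⟩
  · rw [g_eq_zero hab, smul_zero]; exact zero_mem _

theorem x_mul_x_smul_g_mem_lower {n : ℕ} {a b c d : L}
    (h : height c + height d + height a + height b < n) :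
    (x K c * x K d) • g K a b ∈ lower K L n := by
  refine Submodule.subset_span ⟨Finsupp.single c 1 + Finsupp.single d 1, a, b, ?_, ?_⟩
  · rw [map_add, wt_single, wt_single]; exact h
  · rw [x, x, X, X, monomial_mul, one_mul]

variable (K L) in
/-- The sum of the span of the listed syzygies and the terms of weight less than `n`. -/
noncomputable def spanLower (n : ℕ) : Submodule K (FreeMod K L) :=
  (typeSpan K L).restrictScalars K ⊔ lower K L n

theorem monomial_smul_mem_spanLower {n : ℕ} {s : FreeMod K L} (hs : s ∈ spanLower K L n)
    (v : L →₀ ℕ) : monomial v (1 : K) • s ∈ spanLower K L (n + wt v) := by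
  obtain ⟨e, he, r, hr, rfl⟩ := Submodule.mem_sup.1 hs
  rw [smul_add]
  exact Submodule.add_mem_sup ((typeSpan K L).smul_mem _ he) (monomial_smul_mem_lower hr v)

theorem mem_typeSpan {T : Set (FreeMod K L)} {s : FreeMod K L} (hs : s ∈ T)
    (hT : T ⊆ typeS1 K L ∪ typeS2 K L ∪ typeL K L ∪ typeB1 K L ∪ typeB2 K L ∪ typeG1 K L ∪
      typeG2 K L ∪ typeG3 K L ∪ typeG4 K L ∪ typeG5 K L ∪ typeG6 K L ∪ typeG K L ∪ typeD K L := by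
        intro _ h; simp [h]) :
    s ∈ typeSpan K L :=
  Submodule.subset_span (hT hs)

theorem mem_spanLower_of_sub_mem {n : ℕ} {s e : FreeMod K L} (he : e ∈ typeSpan K L)
    (h : s - e ∈ lower K L n) : s ∈ spanLower K L n := by
  rw [← add_sub_cancel e s]
  exact Submodule.add_mem_sup he h

/-- The opposite comparison `a ⊔ c ≤ b` would give `a ≤ b`. So the case analysis over the types
needs to branch only on one-sided inequalities. -/
theorem le_sup_of_not_inc {a b c : L} (h : Inc a b) (h' : ¬ Inc b (a ⊔ c)) : b ≤ a ⊔ c := by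
  by_contra hc
  exact h' ⟨hc, fun h2 => h.1 (le_sup_left.trans h2)⟩

theorem inf_le_of_not_inc {a b c : L} (h : Inc a b) (h' : ¬ Inc b (a ⊓ c)) : a ⊓ c ≤ b := by
  by_contra hc
  exact h' ⟨fun h2 => h.2 (h2.trans inf_le_left), hc⟩

variable (K) in
/-- The critical part of the S-pair of the diamonds `(α, β₁)` and `(α, β₂)`. -/
noncomputable def sPair (α β₁ β₂ : L) : FreeMod K L := x K β₂ • g K α β₁ - x K β₁ • g K α β₂

theorem sPair_swap (α β₁ β₂ : L) : sPair K α β₂ β₁ = -sPair K α β₁ β₂ := (neg_sub _ _).symm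

theorem sPair_mem_of_le [Finite L] {α β₁ β₂ : L} (h1 : Inc α β₁) (h2 : Inc α β₂) (hle : β₁ ≤ β₂)
    (hne : β₁ ≠ β₂) :
    sPair K α β₁ β₂ ∈ spanLower K L (height α + height β₁ + height β₂) := by
  have k1 := height_sup_add_inf_lt h1
  have k2 := height_sup_add_inf_lt h2
  by_cases hJ : β₂ ≤ α ⊔ β₁
  · by_cases hM : α ⊓ β₂ ≤ β₁
    -- Otherwise `β₁ ≤ β₂` would have the same join and the same meet with `α`, forcing equality by
    -- distributivity.
    · refine absurd (hle.antisymm ?_) hne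
      rw [← inf_eq_left.2 hJ, inf_sup_left, inf_comm β₂ α]
      exact sup_le hM inf_le_right
    have hI : Inc β₁ (α ⊓ β₂) := by
      by_contra h; exact hM (inf_le_of_not_inc h1 h)
    have e1 : β₁ ⊔ α ⊓ β₂ = β₂ := by
      rw [sup_inf_left, sup_eq_right.2 hle, sup_comm, inf_eq_right.2 hJ]
    have e2 : β₁ ⊓ (α ⊓ β₂) = β₁ ⊓ α := by
      rw [← inf_assoc, inf_eq_left.2 (inf_le_left.trans hle)]
    -- The dual strip, with equal joins, is covered by `S₂` with the roles permuted: `β₁` plays `α`,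
    -- and the chain is `α ⊓ β₂ ≤ α`.
    have he : x K (β₁ ⊔ α) • g K β₁ (α ⊓ β₂) - x K (β₁ ⊔ (α ⊓ β₂)) • g K β₁ α
        + x K β₁ • g K α (β₁ ⊔ (α ⊓ β₂)) ∈ typeS2 K L := by
      refine ⟨β₁, α ⊓ β₂, α, hI, h1.symm, ?_, e2, inf_le_left, inf_le_left.trans le_sup_right,
        ?_, ?_, inf_le_right.trans inf_le_left, rfl⟩
      · rw [e1]
        intro h
        exact h2.1 (le_sup_right.trans h.ge)
      · exact le_inf inf_le_right (inf_le_left.trans hle)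
      · rw [e1]; exact h2
    refine mem_spanLower_of_sub_mem (neg_mem (mem_typeSpan he)) (?_ : _ ∈ lower K L _)
    have : sPair K α β₁ β₂ - -(x K (β₁ ⊔ α) • g K β₁ (α ⊓ β₂)
        - x K (β₁ ⊔ (α ⊓ β₂)) • g K β₁ α + x K β₁ • g K α (β₁ ⊔ (α ⊓ β₂))) =
        x K (β₁ ⊔ α) • g K β₁ (α ⊓ β₂) := by
      rw [e1, sPair, g_comm β₁ α]; module
    rw [this]
    refine x_smul_g_mem_lower fun _ => ?_
    rw [sup_comm, le_antisymm (sup_le le_sup_left (hle.trans le_sup_right) :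
      α ⊔ β₁ ≤ α ⊔ β₂) (sup_le le_sup_left hJ)]
    omega
  have hI : Inc β₂ (α ⊔ β₁) := by
    by_contra h; exact hJ (le_sup_of_not_inc h2 h)
  have hne' : α ⊔ β₁ ≠ α ⊔ β₂ := fun h => hJ (le_sup_right.trans h.ge)
  by_cases hM : α ⊓ β₂ ≤ β₁
  · have hm : α ⊓ β₁ = α ⊓ β₂ := le_antisymm (inf_le_inf_left _ hle) (le_inf inf_le_left hM)
    have he : -x K β₂ • g K α β₁ + x K β₁ • g K α β₂ - x K (α ⊓ β₁) • g K β₂ (α ⊔ β₁) ∈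
        typeS1 K L :=
      ⟨α, β₁, β₂, h1, h2, hne', hm, hle, hle.trans le_sup_right, hM, hI,
        inf_le_right.trans hle, rfl⟩
    refine mem_spanLower_of_sub_mem (neg_mem (mem_typeSpan he)) (?_ : _ ∈ lower K L _)
    have : sPair K α β₁ β₂ - -(-x K β₂ • g K α β₁ + x K β₁ • g K α β₂
        - x K (α ⊓ β₁) • g K β₂ (α ⊔ β₁)) = -(x K (α ⊓ β₁) • g K β₂ (α ⊔ β₁)) := by
      rw [sPair]; module
    rw [this]
    exact neg_mem (x_smul_g_mem_lower fun _ => by omega)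
  · have hI' : Inc β₁ (α ⊓ β₂) := by
      by_contra h; exact hM (inf_le_of_not_inc h1 h)
    have he : -x K β₂ • g K α β₁ + x K β₁ • g K α β₂
        + x K (α ⊔ β₂) • g K β₁ (α ⊓ β₂) - x K (α ⊓ β₁) • g K β₂ (α ⊔ β₁) ∈ typeL K L :=
      ⟨α, β₁, β₂, h1, h2, fun h => hM (h.ge.trans inf_le_right), hne', hle,
        hle.trans le_sup_right, hI', hI, inf_le_right.trans hle, rfl⟩
    refine mem_spanLower_of_sub_mem (neg_mem (mem_typeSpan he)) (?_ : _ ∈ lower K L _)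
    have : sPair K α β₁ β₂ - -(-x K β₂ • g K α β₁ + x K β₁ • g K α β₂
        + x K (α ⊔ β₂) • g K β₁ (α ⊓ β₂) - x K (α ⊓ β₁) • g K β₂ (α ⊔ β₁)) =
        x K (α ⊔ β₂) • g K β₁ (α ⊓ β₂) - x K (α ⊓ β₁) • g K β₂ (α ⊔ β₁) := by
      rw [sPair]; module
    rw [this]
    exact sub_mem (x_smul_g_mem_lower fun _ => by omega) (x_smul_g_mem_lower fun _ => by omega)

end Filtration

end Hibi

namespace Hibi

/-! ### Critical pairs with incomparable `β₁`, `β₂`, and Koszul pairs. -/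

section Pairs

variable {K L : Type*} [Field K] [DistribLattice L] [Finite L]

/-- By distributivity `β₁ = (α ⊓ β₁) ⊔ (β₁ ⊓ β₂)`, so `α ⊓ β₁ ≤ β₂` is impossible. Only `G₂`, `B₁`
and `G₃` remain. -/
theorem sPair_mem_of_inc_of_le {α β₁ β₂ : L} (h1 : Inc α β₁) (h2 : Inc α β₂) (h12 : Inc β₁ β₂)
    (ha1 : β₁ ≤ α ⊔ β₂) :
    sPair K α β₁ β₂ ∈ spanLower K L (height α + height β₁ + height β₂) := by
  have k1 := height_sup_add_inf_lt h1
  have k2 := height_sup_add_inf_lt h2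
  have hb2 : ¬ α ⊓ β₁ ≤ β₂ := by
    intro hb
    refine h12.1 ?_
    rw [← inf_eq_left.2 ha1, inf_sup_left, inf_comm β₁ α]
    exact sup_le hb inf_le_right
  have hI2 : Inc β₂ (α ⊓ β₁) := by
    by_contra h; exact hb2 (inf_le_of_not_inc h2 h)
  have hm : α ⊓ β₁ ≠ α ⊓ β₂ := fun h => hb2 (h.le.trans inf_le_right)
  have e1 : β₂ ⊔ (α ⊓ β₁) = β₁ ⊔ β₂ := by
    rw [sup_inf_left, sup_comm β₂ α, sup_comm β₂ β₁]
    exact inf_eq_right.2 (sup_le ha1 le_sup_right)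
  by_cases ha2 : β₂ ≤ α ⊔ β₁
  · have hj : α ⊔ β₁ = α ⊔ β₂ :=
      le_antisymm (sup_le le_sup_left ha1) (sup_le le_sup_left ha2)
    have hb1 : ¬ α ⊓ β₂ ≤ β₁ := by
      intro hb
      refine h12.2 ?_
      rw [← inf_eq_left.2 ha2, inf_sup_left, inf_comm β₂ α]
      exact sup_le hb inf_le_right
    have hI1 : Inc β₁ (α ⊓ β₂) := by
      by_contra h; exact hb1 (inf_le_of_not_inc h1 h)
    have he : _ ∈ typeG2 K L :=
      ⟨α, β₁, β₂, h1, h2, hm, hj, h12, ha1, hI1, ha2, hI2, rfl⟩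
    refine mem_spanLower_of_sub_mem (mem_typeSpan he) (?_ : _ ∈ lower K L _)
    rw [show sPair K α β₁ β₂ - (x K β₂ • g K α β₁ - x K β₁ • g K α β₂
        - x K (α ⊔ β₁) • g K β₁ (α ⊓ β₂) + x K (α ⊔ β₁) • g K β₂ (α ⊓ β₁)) =
        x K (α ⊔ β₁) • g K β₁ (α ⊓ β₂) - x K (α ⊔ β₁) • g K β₂ (α ⊓ β₁) by
      rw [sPair]; module]
    exact sub_mem (x_smul_g_mem_lower fun _ => by rw [hj]; omega)
      (x_smul_g_mem_lower fun _ => by omega)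
  have hI : Inc β₂ (α ⊔ β₁) := by
    by_contra h; exact ha2 (le_sup_of_not_inc h2 h)
  have hj : α ⊔ β₁ ≠ α ⊔ β₂ := fun h => ha2 (le_sup_right.trans h.ge)
  -- The last term of `B₁` or `G₃` arises by two straightenings: `α, β₁` to their join and meet,
  -- then that meet with `β₂`. The first lowers the weight strictly, so a weak inequality suffices
  -- for the second.
  have k3 := height_sup_add_inf_le β₂ (α ⊓ β₁)
  by_cases hb1 : α ⊓ β₂ ≤ β₁
  · have he : _ ∈ typeB1 K L :=
      ⟨α, β₁, β₂, h1, h2, hm, hj, h12, ha1, hb1, hI, hI2, rfl⟩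
    refine mem_spanLower_of_sub_mem (neg_mem (mem_typeSpan he)) (?_ : _ ∈ lower K L _)
    rw [show sPair K α β₁ β₂ - -(-x K β₂ • g K α β₁ + x K β₁ • g K α β₂
        - x K (α ⊔ β₁) • g K β₂ (α ⊓ β₁) - x K (α ⊓ β₂) • g K (α ⊔ β₁) (β₁ ⊔ β₂)) =
        -(x K (α ⊔ β₁) • g K β₂ (α ⊓ β₁) + x K (α ⊓ β₂) • g K (α ⊔ β₁) (β₁ ⊔ β₂)) by
      rw [sPair]; module]
    refine neg_mem (add_mem (x_smul_g_mem_lower fun _ => by omega)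
      (x_smul_g_mem_lower fun _ => ?_))
    rw [e1, inf_comm β₂, inf_right_comm, inf_eq_left.2 hb1] at k3
    omega
  · have hI1 : Inc β₁ (α ⊓ β₂) := by
      by_contra h; exact hb1 (inf_le_of_not_inc h1 h)
    have he : _ ∈ typeG3 K L :=
      ⟨α, β₁, β₂, h1, h2, hj, hm, h12, ha1, hI1, hI, hI2, rfl⟩
    refine mem_spanLower_of_sub_mem (mem_typeSpan he) (?_ : _ ∈ lower K L _)
    rw [show sPair K α β₁ β₂ - (x K β₂ • g K α β₁ - x K β₁ • g K α β₂
        - x K (α ⊔ β₂) • g K β₁ (α ⊓ β₂) + x K (α ⊔ β₁) • g K β₂ (α ⊓ β₁)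
        + x K (α ⊓ β₁ ⊓ β₂) • g K (α ⊔ β₁) (β₁ ⊔ β₂)) =
        x K (α ⊔ β₂) • g K β₁ (α ⊓ β₂) - x K (α ⊔ β₁) • g K β₂ (α ⊓ β₁)
        - x K (α ⊓ β₁ ⊓ β₂) • g K (α ⊔ β₁) (β₁ ⊔ β₂) by rw [sPair]; module]
    refine sub_mem (sub_mem (x_smul_g_mem_lower fun _ => by omega)
      (x_smul_g_mem_lower fun _ => by omega)) (x_smul_g_mem_lower fun _ => ?_)
    rw [e1, inf_comm β₂] at k3
    omega

theorem sPair_mem_of_inc_of_inf_le {α β₁ β₂ : L} (h1 : Inc α β₁) (h2 : Inc α β₂)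
    (h12 : Inc β₁ β₂) (ha1 : ¬ β₁ ≤ α ⊔ β₂) (ha2 : ¬ β₂ ≤ α ⊔ β₁) (hb1 : α ⊓ β₂ ≤ β₁) :
    sPair K α β₁ β₂ ∈ spanLower K L (height α + height β₁ + height β₂) := by
  have k1 := height_sup_add_inf_lt h1
  have k2 := height_sup_add_inf_lt h2
  have hI1 : Inc β₁ (α ⊔ β₂) := by
    by_contra h; exact ha1 (le_sup_of_not_inc h1 h)
  have hI2 : Inc β₂ (α ⊔ β₁) := by
    by_contra h; exact ha2 (le_sup_of_not_inc h2 h)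
  have hj : α ⊔ β₁ ≠ α ⊔ β₂ := fun h => ha2 (le_sup_right.trans h.ge)
  by_cases hb2 : α ⊓ β₁ ≤ β₂
  · have hm : α ⊓ β₁ = α ⊓ β₂ :=
      le_antisymm (le_inf inf_le_left hb2) (le_inf inf_le_left hb1)
    have he : _ ∈ typeG1 K L :=
      ⟨α, β₁, β₂, h1, h2, hj, hm, h12, hI1, hb1, hI2, hb2, rfl⟩
    refine mem_spanLower_of_sub_mem (mem_typeSpan he) (?_ : _ ∈ lower K L _)
    rw [show sPair K α β₁ β₂ - (x K β₂ • g K α β₁ - x K β₁ • g K α β₂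
        - x K (α ⊓ β₁) • g K β₁ (α ⊔ β₂) + x K (α ⊓ β₁) • g K β₂ (α ⊔ β₁)) =
        x K (α ⊓ β₁) • g K β₁ (α ⊔ β₂) - x K (α ⊓ β₁) • g K β₂ (α ⊔ β₁) by
      rw [sPair]; module]
    exact sub_mem (x_smul_g_mem_lower fun _ => by rw [hm]; omega)
      (x_smul_g_mem_lower fun _ => by omega)
  · have hI : Inc β₂ (α ⊓ β₁) := by
      by_contra h; exact hb2 (inf_le_of_not_inc h2 h)
    have hm : α ⊓ β₁ ≠ α ⊓ β₂ := fun h => hb2 (h.le.trans inf_le_right)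
    have he : _ ∈ typeG4 K L :=
      ⟨α, β₁, β₂, h1, h2, hj, hm, h12, hI1, hb1, hI2, hI, rfl⟩
    refine mem_spanLower_of_sub_mem (mem_typeSpan he) (?_ : _ ∈ lower K L _)
    rw [show sPair K α β₁ β₂ - (x K β₂ • g K α β₁ - x K β₁ • g K α β₂
        + x K (α ⊓ β₁) • g K β₂ (α ⊔ β₁) - x K (α ⊓ β₂) • g K β₁ (α ⊔ β₂)
        + x K (α ⊔ β₁ ⊔ β₂) • g K (α ⊓ β₁) (β₁ ⊓ β₂)) =
        x K (α ⊓ β₂) • g K β₁ (α ⊔ β₂) - x K (α ⊓ β₁) • g K β₂ (α ⊔ β₁)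
        - x K (α ⊔ β₁ ⊔ β₂) • g K (α ⊓ β₁) (β₁ ⊓ β₂) by rw [sPair]; module]
    refine sub_mem (sub_mem (x_smul_g_mem_lower fun _ => by omega)
      (x_smul_g_mem_lower fun _ => by omega)) (x_smul_g_mem_lower fun _ => ?_)
    have k3 := height_sup_add_inf_le β₂ (α ⊔ β₁)
    have e3 : β₂ ⊓ (α ⊔ β₁) = β₁ ⊓ β₂ := by
      rw [inf_sup_left, inf_comm β₂ α, inf_comm β₂ β₁]
      exact sup_eq_right.2 (le_inf hb1 inf_le_right)
    rw [e3, sup_comm β₂] at k3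
    omega

/-- Exchanging `β₁` and `β₂` only changes the sign of the S-pair, so if any of the four inequalities
holds an earlier case applies. If none holds, the type is `G`. -/
theorem sPair_mem_of_inc {α β₁ β₂ : L} (h1 : Inc α β₁) (h2 : Inc α β₂) (h12 : Inc β₁ β₂) :
    sPair K α β₁ β₂ ∈ spanLower K L (height α + height β₁ + height β₂) := by
  by_cases ha1 : β₁ ≤ α ⊔ β₂
  · exact sPair_mem_of_inc_of_le h1 h2 h12 ha1
  by_cases ha2 : β₂ ≤ α ⊔ β₁
  · rw [sPair_swap, add_right_comm]
    exact neg_mem (sPair_mem_of_inc_of_le h2 h1 h12.symm ha2)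
  by_cases hb1 : α ⊓ β₂ ≤ β₁
  · exact sPair_mem_of_inc_of_inf_le h1 h2 h12 ha1 ha2 hb1
  by_cases hb2 : α ⊓ β₁ ≤ β₂
  · rw [sPair_swap, add_right_comm]
    exact neg_mem (sPair_mem_of_inc_of_inf_le h2 h1 h12.symm ha2 ha1 hb2)
  have k1 := height_sup_add_inf_lt h1
  have k2 := height_sup_add_inf_lt h2
  have k3 := height_sup_add_inf_le β₂ (α ⊓ β₁)
  have k4 := height_sup_add_inf_le β₁ (α ⊓ β₂)
  rw [inf_comm β₂] at k3
  rw [inf_comm β₁, inf_right_comm] at k4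
  have hI1 : Inc β₁ (α ⊔ β₂) := by
    by_contra h; exact ha1 (le_sup_of_not_inc h1 h)
  have hI2 : Inc β₂ (α ⊔ β₁) := by
    by_contra h; exact ha2 (le_sup_of_not_inc h2 h)
  have hI3 : Inc β₁ (α ⊓ β₂) := by
    by_contra h; exact hb1 (inf_le_of_not_inc h1 h)
  have hI4 : Inc β₂ (α ⊓ β₁) := by
    by_contra h; exact hb2 (inf_le_of_not_inc h2 h)
  have he : _ ∈ typeG K L :=
    ⟨α, β₁, β₂, h1, h2, fun h => ha2 (le_sup_right.trans h.ge),
      fun h => hb2 (h.le.trans inf_le_right), h12, hI1, hI3, hI2, hI4, rfl⟩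
  refine mem_spanLower_of_sub_mem (mem_typeSpan he) (?_ : _ ∈ lower K L _)
  rw [show sPair K α β₁ β₂ - (x K β₂ • g K α β₁ - x K β₁ • g K α β₂
      - x K (α ⊔ β₂) • g K β₁ (α ⊓ β₂) + x K (α ⊔ β₁) • g K β₂ (α ⊓ β₁)
      - x K (α ⊓ β₁ ⊓ β₂) • g K (β₁ ⊔ (α ⊓ β₂)) (α ⊔ β₂)
      + x K (α ⊓ β₁ ⊓ β₂) • g K (β₂ ⊔ (α ⊓ β₁)) (α ⊔ β₁)) =
      x K (α ⊔ β₂) • g K β₁ (α ⊓ β₂) - x K (α ⊔ β₁) • g K β₂ (α ⊓ β₁)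
      + x K (α ⊓ β₁ ⊓ β₂) • g K (β₁ ⊔ (α ⊓ β₂)) (α ⊔ β₂)
      - x K (α ⊓ β₁ ⊓ β₂) • g K (β₂ ⊔ (α ⊓ β₁)) (α ⊔ β₁) by rw [sPair]; module]
  exact sub_mem (add_mem (sub_mem (x_smul_g_mem_lower fun _ => by omega)
    (x_smul_g_mem_lower fun _ => by omega)) (x_smul_g_mem_lower fun _ => by omega))
    (x_smul_g_mem_lower fun _ => by omega)

theorem sPair_mem {α β₁ β₂ : L} (h1 : Inc α β₁) (h2 : Inc α β₂) :
    sPair K α β₁ β₂ ∈ spanLower K L (height α + height β₁ + height β₂) := by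
  by_cases hne : β₁ = β₂
  · rw [hne, sPair, sub_self]; exact zero_mem _
  by_cases h : β₁ ≤ β₂
  · exact sPair_mem_of_le h1 h2 h hne
  by_cases h' : β₂ ≤ β₁
  · rw [sPair_swap, add_right_comm]
    exact neg_mem (sPair_mem_of_le h2 h1 h' (Ne.symm hne))
  · exact sPair_mem_of_inc h1 h2 ⟨h, h'⟩

/-- A pair with meet `b` and join `d` exists only if `b ≤ d`, so the side condition of type `D` is
met. The opposite inequality is handled by exchanging the two diamonds. -/
theorem koszul_mem_of_not_le {a b c d : L} (hab : Inc a b) (hcd : Inc c d) (hac : a ≠ c)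
    (had : a ≠ d) (hbc : b ≠ c) (hbd : b ≠ d) (h : ¬ b ≤ d) :
    (x K c * x K d) • g K a b - (x K a * x K b) • g K c d ∈
      spanLower K L (height a + height b + height c + height d) := by
  have he : _ ∈ typeD K L := ⟨a, b, c, d, hab, hcd, hac, had, hbc, hbd, by
    rintro ⟨p, q, rfl, rfl⟩; exact h inf_le_sup, rfl⟩
  refine mem_spanLower_of_sub_mem (mem_typeSpan he) (?_ : _ ∈ lower K L _)
  rw [show (x K c * x K d) • g K a b - (x K a * x K b) • g K c d
      - ((x K c * x K d - x K (c ⊔ d) * x K (c ⊓ d)) • g K a b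
      - (x K a * x K b - x K (a ⊔ b) * x K (a ⊓ b)) • g K c d) =
      (x K (c ⊔ d) * x K (c ⊓ d)) • g K a b - (x K (a ⊔ b) * x K (a ⊓ b)) • g K c d by module]
  have k1 := height_sup_add_inf_lt hab
  have k2 := height_sup_add_inf_lt hcd
  exact sub_mem (x_mul_x_smul_g_mem_lower (by omega)) (x_mul_x_smul_g_mem_lower (by omega))

theorem koszul_mem {a b c d : L} (hab : Inc a b) (hcd : Inc c d) (hac : a ≠ c)
    (had : a ≠ d) (hbc : b ≠ c) (hbd : b ≠ d) :
    (x K c * x K d) • g K a b - (x K a * x K b) • g K c d ∈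
      spanLower K L (height a + height b + height c + height d) := by
  by_cases h : b ≤ d
  · rw [← neg_sub, show height a + height b + height c + height d =
      height c + height d + height a + height b by omega]
    exact neg_mem (koszul_mem_of_not_le hcd hab hac.symm hbc.symm had.symm hbd.symm
      fun h' => hbd (le_antisymm h h'))
  · exact koszul_mem_of_not_le hab hcd hac had hbc hbd h

end Pairs

/-! ### Lifting leading monomials and descent on the weight. -/

section Main

variable {K L : Type*} [Field K]

theorem exists_eq_add_single {a b : L} {u v : L →₀ ℕ} (hab : a ≠ b)
    (h : u + Finsupp.single a 1 = v + Finsupp.single b 1) :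
    ∃ t, u = t + Finsupp.single b 1 ∧ v = t + Finsupp.single a 1 := by
  have hb : Finsupp.single b 1 ≤ u := by
    rw [Finsupp.single_le_iff]
    have := DFunLike.congr_fun h b
    rw [Finsupp.add_apply, Finsupp.add_apply, Finsupp.single_eq_same,
      Finsupp.single_eq_of_ne (Ne.symm hab)] at this
    omega
  refine ⟨u - Finsupp.single b 1, (tsub_add_cancel_of_le hb).symm, ?_⟩
  apply add_right_cancel (b := Finsupp.single b 1)
  rw [← h, add_right_comm, tsub_add_cancel_of_le hb]

theorem monomial_add_single (u : L →₀ ℕ) (a : L) :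
    monomial (u + Finsupp.single a 1) (1 : K) = monomial u 1 * x K a := by
  rw [x, X, monomial_mul, one_mul]

variable [DistribLattice L]

theorem monomial_smul_g_sub_mem_of_left [Finite L] {a b d : L} (hab : Inc a b) (had : Inc a d)
    {u v : L →₀ ℕ} {n : ℕ} (hn : wt u + height a + height b = n)
    (h : u + Finsupp.single a 1 + Finsupp.single b 1 =
      v + Finsupp.single a 1 + Finsupp.single d 1) :
    monomial u (1 : K) • g K a b - monomial v (1 : K) • g K a d ∈ spanLower K L n := by
  rw [add_right_comm, add_right_comm v, add_left_inj] at h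
  by_cases hbd : b = d
  · subst hbd
    rw [add_left_inj] at h
    rw [h, sub_self]
    exact zero_mem _
  obtain ⟨t, rfl, rfl⟩ := exists_eq_add_single hbd h
  have := monomial_smul_mem_spanLower (sPair_mem (K := K) hab had) t
  rw [sPair, smul_sub, smul_smul, smul_smul, ← monomial_add_single, ← monomial_add_single] at this
  convert this using 2
  rw [← hn, map_add, wt_single]
  omega

theorem monomial_smul_g_sub_mem [Finite L] {a b c d : L} (hab : Inc a b) (hcd : Inc c d)
    {u v : L →₀ ℕ} {n : ℕ} (hn : wt u + height a + height b = n)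
    (h : u + Finsupp.single a 1 + Finsupp.single b 1 =
      v + Finsupp.single c 1 + Finsupp.single d 1) :
    monomial u (1 : K) • g K a b - monomial v (1 : K) • g K c d ∈ spanLower K L n := by
  by_cases hac : a = c
  · subst hac
    exact monomial_smul_g_sub_mem_of_left hab hcd hn h
  by_cases had : a = d
  · subst had
    rw [g_comm c]
    exact monomial_smul_g_sub_mem_of_left hab hcd.symm hn (h.trans (add_right_comm _ _ _))
  by_cases hbc : b = c
  · subst hbc
    rw [g_comm a]
    exact monomial_smul_g_sub_mem_of_left hab.symm hcd (by omega)
      ((add_right_comm _ _ _).trans h)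
  by_cases hbd : b = d
  · subst hbd
    rw [g_comm a, g_comm c]
    exact monomial_smul_g_sub_mem_of_left hab.symm hcd.symm (by omega)
      ((add_right_comm _ _ _).trans (h.trans (add_right_comm _ _ _)))
  -- The diamonds are now disjoint. Peeling off the four variables gives `u = t + c + d` and `v = t
  -- + a + b` in exponents, so the difference is `t` times a Koszul pair.
  obtain ⟨t₁, h1, h2⟩ := exists_eq_add_single hbd h
  obtain ⟨t₂, rfl, rfl⟩ := exists_eq_add_single had h1
  obtain ⟨t₃, rfl, h3⟩ := exists_eq_add_single (Ne.symm hbc) h2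
  obtain ⟨t, rfl, rfl⟩ := exists_eq_add_single hac h3
  have := monomial_smul_mem_spanLower (koszul_mem (K := K) hab hcd hac had hbc hbd) t
  rw [smul_sub, smul_smul, smul_smul, ← mul_assoc, ← mul_assoc] at this
  simp only [monomial_add_single]
  convert this using 2
  rw [← hn, map_add, map_add, wt_single, wt_single]
  omega

open Classical in
variable (K) in
/-- A term `m • g_(a,b)` with `m x_a x_b` the monomial `w`, or `0` if there is none. -/
noncomputable def lift (w : L →₀ ℕ) : FreeMod K L :=
  if h : ∃ (u : L →₀ ℕ) (a b : L), Inc a b ∧ u + Finsupp.single a 1 + Finsupp.single b 1 = w then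
    monomial h.choose (1 : K) • g K h.choose_spec.choose h.choose_spec.choose_spec.choose
  else 0

theorem monomial_smul_g_sub_lift_mem [Finite L] {a b : L} (hab : Inc a b)
    {u : L →₀ ℕ} {n : ℕ} (hn : wt u + height a + height b = n) :
    monomial u (1 : K) • g K a b - lift K (u + Finsupp.single a 1 + Finsupp.single b 1) ∈
      spanLower K L n := by
  have h : ∃ (u' : L →₀ ℕ) (a' b' : L), Inc a' b' ∧
      u' + Finsupp.single a' 1 + Finsupp.single b' 1 =
        u + Finsupp.single a 1 + Finsupp.single b 1 := ⟨u, a, b, hab, rfl⟩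
  have hs := h.choose_spec.choose_spec.choose_spec
  rw [lift, dif_pos h]
  exact monomial_smul_g_sub_mem hab hs.1 hn hs.2.symm

variable (K L) in
/-- The linear map sending monomials of weight `n` to their chosen lifts, and the others to `0`. -/
noncomputable def liftTop (n : ℕ) : MvPolynomial L K →ₗ[K] FreeMod K L :=
  (basisMonomials L K).constr K fun w => if wt w = n then lift K w else 0

theorem liftTop_monomial (n : ℕ) (w : L →₀ ℕ) :
    liftTop K L n (monomial w 1) = if wt w = n then lift K w else 0 := by
  have := (basisMonomials L K).constr_basis K (fun w => if wt w = n then lift K w else 0) w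
  rwa [coe_basisMonomials] at this

theorem lower_mono {m n : ℕ} (h : m ≤ n) : lower K L m ≤ lower K L n :=
  Submodule.span_mono fun _ ⟨u, a, b, hu, hs⟩ => ⟨u, a, b, hu.trans_le h, hs⟩

/-- The claim is `K`-linear, so it is checked on a single term. The non-leading monomial of its
image has weight below `n` and is killed by `liftTop`; the leading one, if of weight `n`, returns a
lift equivalent to the original term. -/
theorem sub_liftTop_phi_mem [Finite L] {n : ℕ} {s : FreeMod K L} (hs : s ∈ lower K L (n + 1)) :
    s - liftTop K L n (phi K L s) ∈ spanLower K L n := by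
  induction hs using Submodule.span_induction with
  | mem s h =>
    obtain ⟨u, a, b, h, rfl⟩ := h
    by_cases hab : Inc a b
    · have k := height_sup_add_inf_lt hab
      have e : phi K L (monomial u (1 : K) • g K a b) =
          monomial (u + Finsupp.single a 1 + Finsupp.single b 1) 1
            - monomial (u + Finsupp.single (a ⊔ b) 1 + Finsupp.single (a ⊓ b) 1) 1 := by
        rw [map_smul, phi_g]
        simp only [monomial_add_single, smul_eq_mul]
        ring
      rw [e, map_sub, liftTop_monomial, liftTop_monomial]
      simp only [map_add, wt_single]
      rw [if_neg (c := wt u + height (a ⊔ b) + height (a ⊓ b) = n) (by omega), sub_zero]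
      split_ifs with hn
      · exact monomial_smul_g_sub_lift_mem hab hn
      · rw [sub_zero]
        exact Submodule.mem_sup_right (Submodule.subset_span ⟨u, a, b, by omega, rfl⟩)
    · rw [g_eq_zero hab, smul_zero, map_zero, map_zero, sub_zero]
      exact zero_mem _
  | zero => rw [map_zero, map_zero, sub_zero]; exact zero_mem _
  | add s t _ _ hs ht =>
    rw [map_add, map_add, add_sub_add_comm]
    exact add_mem hs ht
  | smul c s _ hs =>
    rw [LinearMap.map_smul_of_tower, map_smul, ← smul_sub]
    exact Submodule.smul_mem _ c hs

theorem mem_typeSpan_of_mem_lower [Finite L] (n : ℕ) :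
    ∀ s ∈ lower K L n, phi K L s = 0 → s ∈ typeSpan K L := by
  induction n with
  | zero =>
    intro s hs _
    have : lower K L 0 = ⊥ := by
      rw [lower, Submodule.span_eq_bot]
      rintro _ ⟨_, _, _, h, _⟩
      omega
    rw [this, Submodule.mem_bot] at hs
    rw [hs]
    exact zero_mem _
  | succ n ih =>
    intro s hs h0
    have h1 := sub_liftTop_phi_mem hs
    rw [h0, map_zero, sub_zero] at h1
    -- The listed part `e` is itself a syzygy, so the remainder `r` of smaller weight is one too and
    -- the induction applies to it.
    obtain ⟨e, he, r, hr, rfl⟩ := Submodule.mem_sup.1 h1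
    have he0 : phi K L e = 0 := typeSpan_le he
    rw [map_add, he0, zero_add] at h0
    exact add_mem he (ih r hr h0)

theorem exists_mem_lower (s : FreeMod K L) : ∃ n, s ∈ lower K L n := by
  have hadd : ∀ s t : FreeMod K L, (∃ n, s ∈ lower K L n) → (∃ n, t ∈ lower K L n) →
      ∃ n, s + t ∈ lower K L n := fun s t ⟨m, hm⟩ ⟨n, hn⟩ =>
    ⟨max m n, add_mem (lower_mono (le_max_left m n) hm) (lower_mono (le_max_right m n) hn)⟩
  induction s using Finsupp.induction_linear with
  | zero => exact ⟨0, zero_mem _⟩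
  | add s t hs ht => exact hadd s t hs ht
  | single d p =>
    induction p using MvPolynomial.induction_on' with
    | add p q hp hq => rw [Finsupp.single_add]; exact hadd _ _ hp hq
    | monomial u c =>
      have e : (Finsupp.single d (monomial u c) : FreeMod K L) =
          c • monomial u (1 : K) • Finsupp.single d 1 := by
        rw [Finsupp.smul_single, Finsupp.smul_single, smul_eq_mul, mul_one, smul_monomial,
          smul_eq_mul, mul_one]
      rw [e]
      obtain ⟨z, hz⟩ := d
      induction z using Sym2.ind with
      | _ a b =>
        have hab : Inc a b := hz
        refine ⟨wt u + height a + height b + 1, ?_⟩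
        refine Submodule.smul_mem _ c
          (Submodule.subset_span ⟨u, a, b, Nat.lt_succ_self _, ?_⟩)
        rw [g, dif_pos hab]

end Main

end Hibi

theorem mainTheorem1 (K L : Type*) [Field K] [DistribLattice L] [Finite L] :
    Submodule.span (MvPolynomial L K)
      (Hibi.typeS1 K L ∪ Hibi.typeS2 K L ∪ Hibi.typeL K L ∪ Hibi.typeB1 K L ∪ Hibi.typeB2 K L ∪
        Hibi.typeG1 K L ∪ Hibi.typeG2 K L ∪ Hibi.typeG3 K L ∪ Hibi.typeG4 K L ∪
        Hibi.typeG5 K L ∪ Hibi.typeG6 K L ∪ Hibi.typeG K L ∪ Hibi.typeD K L) =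
      Hibi.firstSyzygy K L := by
  refine le_antisymm Hibi.typeSpan_le fun s hs => ?_
  obtain ⟨n, hn⟩ := Hibi.exists_mem_lower s
  exact Hibi.mem_typeSpan_of_mem_lower n s hn hs
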